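/- Let $A$ be a unital $C^*$-algebra and let $\mathrm{Re}(A)$ be its set of self-adjoint elements. An isocone of $A$ is a subset $I\subset \mathrm{Re}(A)$ such that: (1) $x\cdot 1\in I$ for all $x\in\mathbb{R}$; (2) $b+b'\in I$ for all $b,b'\in I$; (3) $\phi(b)\in I$ (continuous functional calculus) for every $b\in I$ and every continuous non-decreasing function $\phi:\mathbb{R}\to\mathbb{R}$; (4) $I$ is norm-closed; (5) $\overline{\{b-b' : b,b'\in I\}}=\mathrm{Re}(A)$. Theorem. Let $N\ge 3$ be an integer. Then the only isocone of $M_N(\mathbb{C})$ is the set $\mathrm{Herm}(N)$ of all Hermitian $N\times N$ matrices; that is, a subset $I$ of $M_N(\mathbb{C})$ is an isocone if and only if $I=\mathrm{Herm}(N)$. -/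

import Mathlib

/-- A (ultraweak) pre-isocone of a unital C⋆-algebra `A`: a closed set `I` of self-adjoint elements
containing the real constants, stable under sums, and stable under the functional calculus by
continuous non-decreasing functions `ℝ → ℝ`.

The definition only uses the topology, the unital real `⋆`-algebra structure, and the continuous
functional calculus on self-adjoint elements, all of which every unital C⋆-algebra has. For
`A = Matrix (Fin N) (Fin N) ℂ` these are Mathlib's instances: the entrywise topology (which is the
topology of the C⋆-norm, as of any norm) and the functional calculus of Hermitian matrices. -/
structure IsPreIsocone {A : Type*} [Ring A] [StarRing A] [TopologicalSpace A] [Algebra ℝ A]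
    [ContinuousFunctionalCalculus ℝ A IsSelfAdjoint] (I : Set A) : Prop where
  isSelfAdjoint : ∀ b ∈ I, IsSelfAdjoint b
  const_mem : ∀ x : ℝ, algebraMap ℝ A x ∈ I
  add_mem : ∀ b ∈ I, ∀ b' ∈ I, b + b' ∈ I
  cfc_mem : ∀ φ : ℝ → ℝ, Continuous φ → Monotone φ → ∀ b ∈ I, cfc φ b ∈ I
  isClosed : IsClosed I

/-- An (ultraweak) isocone: a pre-isocone such that the closure of the set `I - I` of differences
of elements of `I` is the set of all self-adjoint elements. -/
structure IsIsocone {A : Type*} [Ring A] [StarRing A] [TopologicalSpace A] [Algebra ℝ A]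
    [ContinuousFunctionalCalculus ℝ A IsSelfAdjoint] (I : Set A) : Prop
    extends IsPreIsocone I where
  closure_sub : closure {x : A | ∃ b ∈ I, ∃ b' ∈ I, x = b - b'} = {a : A | IsSelfAdjoint a}

/-- The set of Hermitian `N × N` complex matrices. -/
def Herm (N : ℕ) : Set (Matrix (Fin N) (Fin N) ℂ) := {a | a.IsHermitian}

/-! Matrix spectra are finite, so a continuous monotone function can act on one as a step function:
an isocone contains the projections onto upper spectral subspaces of its elements. In finite
dimension `I - I` is already all of the Hermitian matrices, which gives the cone `I` an interior
point. Perturbing that point so that its top eigenvalue is simple, with eigenvector any `v` near a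
fixed `u`, puts `rayProj v` in `I` for an open set of `v` (`IsIsocone.eventually_rayProj_mem`).

For arbitrary `x`, two lines of the plane of `x` and `u` near that of `u` give the projection onto
this plane, as the support of a sum. If `x, u, v` are independent, the planes of `x, u` and of `x,
v` meet in the line of `x`, the top eigenspace of the sum of their projections; hence `rayProj x ∈
I`. This is where `3 ≤ N` enters. Nonnegative combinations of ray projections and real constants
then yield every Hermitian matrix. -/

open Matrix Filter Topology

/-! ### Spectral projections inside a pre-isocone -/

section SpectralProjections

open scoped ComplexOrder

variable {N : ℕ} {I : Set (Matrix (Fin N) (Fin N) ℂ)}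

/-- Continuous functional calculus of a finite-dimensional Hermitian matrix is multiplicative on
arbitrary functions, since the spectrum is finite. -/
theorem Matrix.cfc_mul_of_finite (f g : ℝ → ℝ) (A : Matrix (Fin N) (Fin N) ℂ) :
    cfc (fun t => f t * g t) A = cfc f A * cfc g A :=
  cfc_mul f g A (finite_real_spectrum.continuousOn f) (finite_real_spectrum.continuousOn g)

theorem Matrix.PosSemidef.le_of_mem_spectrum {A : Matrix (Fin N) (Fin N) ℂ} {μ : ℝ}
    (h : (algebraMap ℝ _ μ - A).PosSemidef) {t : ℝ} (ht : t ∈ spectrum ℝ A) : t ≤ μ := by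
  have h1 : μ - t ∈ spectrum ℝ (algebraMap ℝ _ μ - A) := by
    rw [← spectrum.singleton_sub_eq]
    exact Set.sub_mem_sub rfl ht
  rw [h.isHermitian.spectrum_real_eq_range_eigenvalues] at h1
  obtain ⟨i, hi⟩ := h1
  have := h.eigenvalues_nonneg i
  linarith

theorem Matrix.PosSemidef.nonneg_of_mem_spectrum {A : Matrix (Fin N) (Fin N) ℂ}
    (h : A.PosSemidef) {t : ℝ} (ht : t ∈ spectrum ℝ A) : 0 ≤ t := by
  rw [h.isHermitian.spectrum_real_eq_range_eigenvalues] at ht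
  obtain ⟨i, rfl⟩ := ht
  exact h.eigenvalues_nonneg i

theorem IsPreIsocone.isHermitian (hI : IsPreIsocone I) {A : Matrix (Fin N) (Fin N) ℂ}
    (hA : A ∈ I) : A.IsHermitian := hI.isSelfAdjoint A hA

theorem IsPreIsocone.smul_mem (hI : IsPreIsocone I) {r : ℝ} (hr : 0 ≤ r)
    {A : Matrix (Fin N) (Fin N) ℂ} (hA : A ∈ I) : r • A ∈ I := by
  rw [← cfc_const_mul_id r A (hI.isSelfAdjoint A hA)]
  exact hI.cfc_mem _ (by fun_prop) (fun a b hab => mul_le_mul_of_nonneg_left hab hr) A hA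

theorem IsPreIsocone.sum_mem (hI : IsPreIsocone I) {ι : Type*} (s : Finset ι)
    (f : ι → Matrix (Fin N) (Fin N) ℂ) (h : ∀ i ∈ s, f i ∈ I) : ∑ i ∈ s, f i ∈ I := by
  refine Finset.sum_induction f (· ∈ I) (fun a b ha hb => hI.add_mem a ha b hb) ?_ h
  simpa using hI.const_mem 0

/-- Spectral projections onto upper parts of the spectrum across a gap stay in the pre-isocone. -/
theorem IsPreIsocone.spectral_projection_mem (hI : IsPreIsocone I)
    {A : Matrix (Fin N) (Fin N) ℂ} (hA : A ∈ I) {s r : ℝ} (hsr : s < r)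
    (h : ∀ t ∈ spectrum ℝ A, t ≤ s ∨ r ≤ t) :
    cfc (fun t : ℝ => if r ≤ t then (1 : ℝ) else 0) A ∈ I := by
  -- The step function agrees on the spectrum with a continuous ramp rising from 0 at `s` to 1 at
  -- `r`.
  have h1 : cfc (fun t : ℝ => if r ≤ t then (1 : ℝ) else 0) A
      = cfc (fun t : ℝ => max 0 (min 1 ((t - s) / (r - s)))) A := by
    refine cfc_congr fun t ht => ?_
    have hpos : 0 < r - s := sub_pos.2 hsr
    rcases h t ht with h | h
    · have : (t - s) / (r - s) ≤ 0 := div_nonpos_of_nonpos_of_nonneg (by linarith) hpos.le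
      simp only [if_neg (show ¬ r ≤ t by linarith)]
      rw [max_eq_left (min_le_of_right_le this)]
    · have : 1 ≤ (t - s) / (r - s) := by rw [le_div_iff₀ hpos]; linarith
      simp only [if_pos h]
      rw [min_eq_left this, max_eq_right zero_le_one]
  rw [h1]
  refine hI.cfc_mem _ (by fun_prop) (fun a b hab => ?_) A hA
  have hpos : 0 < r - s := sub_pos.2 hsr
  gcongr

theorem IsPreIsocone.exists_top_projection (hI : IsPreIsocone I)
    {A : Matrix (Fin N) (Fin N) ℂ} (hA : A ∈ I) {μ : ℝ}
    (hμ : (algebraMap ℝ _ μ - A).PosSemidef) :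
    ∃ P ∈ I, P * P = P ∧ ∀ y, P *ᵥ y = y ↔ (algebraMap ℝ _ μ - A) *ᵥ y = 0 := by
  have hsa := hI.isSelfAdjoint A hA
  obtain ⟨s, hs, hsμ⟩ : ∃ s, (∀ t ∈ spectrum ℝ A, t ≤ s ∨ μ ≤ t) ∧ s < μ := by
    have : ∀ᶠ s in 𝓝[<] μ, ∀ t ∈ spectrum ℝ A, t ≤ s ∨ μ ≤ t := by
      refine (eventually_all_finite finite_real_spectrum).2 fun t _ => ?_
      rcases lt_or_ge t μ with h | h
      · filter_upwards [Ioo_mem_nhdsLT h] with s hs using .inl hs.1.le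
      · exact .of_forall fun _ => .inr h
    exact (this.and self_mem_nhdsWithin).exists
  set χ : ℝ → ℝ := fun t => if μ ≤ t then 1 else 0 with hχ
  have hD : cfc (fun t : ℝ => μ - t) A = algebraMap ℝ _ μ - A := by
    rw [cfc_sub (fun _ => μ) (fun t : ℝ => t) A, cfc_const μ A, cfc_id' ℝ A]
  refine ⟨cfc χ A, hI.spectral_projection_mem hA hsμ hs, ?_, fun y => ?_⟩
  · rw [← cfc_mul_of_finite]
    congr 1
    ext t
    by_cases h : μ ≤ t <;> simp [hχ, h]
  · have h1 : (algebraMap ℝ _ μ - A) * cfc χ A = 0 := by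
      rw [← hD, ← cfc_mul_of_finite, ← cfc_zero ℝ A]
      refine cfc_congr fun t ht => ?_
      have := hμ.le_of_mem_spectrum ht
      by_cases h : μ ≤ t
      · simp [le_antisymm h this]
      · simp [hχ, h]
    -- The value of the inverse at `t = μ` is irrelevant: the factor `μ - t` and `1 - χ` both vanish
    -- there.
    have h2 : 1 - cfc χ A
        = cfc (fun t : ℝ => (μ - t)⁻¹) A * (algebraMap ℝ _ μ - A) := by
      rw [← hD, ← cfc_mul_of_finite, ← cfc_one ℝ A,
        ← cfc_sub _ _ A (finite_real_spectrum.continuousOn _) (finite_real_spectrum.continuousOn _)]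
      refine cfc_congr fun t ht => ?_
      have := hμ.le_of_mem_spectrum ht
      by_cases h : μ ≤ t
      · simp [hχ, le_antisymm h this]
      · have : μ - t ≠ 0 := by linarith [not_le.1 h]
        simp [hχ, h, this]
    constructor
    · intro h
      rw [← h, mulVec_mulVec, h1, zero_mulVec]
    · intro h
      have h3 : (1 - cfc χ A) *ᵥ y = 0 := by rw [h2, ← mulVec_mulVec, h, mulVec_zero]
      rw [sub_mulVec, one_mulVec, sub_eq_zero] at h3
      exact h3.symm

/-- The spectral gap is now the one just above 0. The factorization `P = A * C`, with `C` a
pseudo-inverse, bounds the range of `P` by that of `A`. -/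
theorem IsPreIsocone.exists_support_projection (hI : IsPreIsocone I)
    {A : Matrix (Fin N) (Fin N) ℂ} (hA : A ∈ I) (hpos : A.PosSemidef) :
    ∃ P ∈ I, P * P = P ∧ P * A = A ∧ ∃ C, P = A * C := by
  have hsa := hI.isSelfAdjoint A hA
  obtain ⟨r, hr, h0r⟩ : ∃ r, (∀ t ∈ spectrum ℝ A, t ≤ 0 ∨ r ≤ t) ∧ 0 < r := by
    have : ∀ᶠ r in 𝓝[>] (0 : ℝ), ∀ t ∈ spectrum ℝ A, t ≤ 0 ∨ r ≤ t := by
      refine (eventually_all_finite finite_real_spectrum).2 fun t _ => ?_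
      rcases lt_or_ge 0 t with h | h
      · filter_upwards [Ioo_mem_nhdsGT h] with s hs using .inr hs.2.le
      · exact .of_forall fun _ => .inl h
    exact (this.and self_mem_nhdsWithin).exists
  set χ : ℝ → ℝ := fun t => if r ≤ t then 1 else 0 with hχ
  have hval : ∀ t ∈ spectrum ℝ A, t = 0 ∨ r ≤ t := fun t ht =>
    (hr t ht).imp_left fun h => le_antisymm h (hpos.nonneg_of_mem_spectrum ht)
  refine ⟨cfc χ A, hI.spectral_projection_mem hA h0r hr, ?_, ?_, cfc (fun t : ℝ => t⁻¹) A, ?_⟩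
  · rw [← cfc_mul_of_finite]
    congr 1
    ext t
    by_cases h : r ≤ t <;> simp [hχ, h]
  · nth_rw 2 3 [← cfc_id' ℝ A]
    rw [← cfc_mul_of_finite]
    refine cfc_congr fun t ht => ?_
    rcases hval t ht with rfl | h
    · simp
    · simp [hχ, h]
  · nth_rw 2 [← cfc_id' ℝ A]
    rw [← cfc_mul_of_finite]
    refine cfc_congr fun t ht => ?_
    rcases hval t ht with rfl | h
    · simp [hχ, h0r]
    · have : t ≠ 0 := by linarith
      simp [hχ, h, this]

end SpectralProjections

/-! ### Interior points of an isocone -/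

section Interior

variable {N : ℕ} {I : Set (Matrix (Fin N) (Fin N) ℂ)}

/-- The algebraic span `I - I`, as a real subspace. -/
def IsPreIsocone.diffSubmodule (hI : IsPreIsocone I) :
    Submodule ℝ (Matrix (Fin N) (Fin N) ℂ) where
  carrier := {x | ∃ b ∈ I, ∃ b' ∈ I, x = b - b'}
  add_mem' := by
    rintro _ _ ⟨b, hb, b', hb', rfl⟩ ⟨c, hc, c', hc', rfl⟩
    exact ⟨b + c, hI.add_mem _ hb _ hc, b' + c', hI.add_mem _ hb' _ hc', by abel⟩
  zero_mem' := ⟨0, by simpa using hI.const_mem 0, 0, by simpa using hI.const_mem 0, by simp⟩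
  smul_mem' := by
    rintro r _ ⟨b, hb, b', hb', rfl⟩
    rcases le_total 0 r with hr | hr
    · exact ⟨r • b, hI.smul_mem hr hb, r • b', hI.smul_mem hr hb', smul_sub _ _ _⟩
    · refine ⟨(-r) • b', hI.smul_mem (by linarith) hb', (-r) • b, hI.smul_mem (by linarith) hb, ?_⟩
      rw [smul_sub, neg_smul, neg_smul]
      abel

/-- Finite-dimensional subspaces are closed, so the closure in the definition adds nothing. -/
theorem IsIsocone.exists_eq_sub (hI : IsIsocone I) {A : Matrix (Fin N) (Fin N) ℂ}
    (hA : A.IsHermitian) : ∃ b ∈ I, ∃ b' ∈ I, A = b - b' := by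
  have hcl : IsClosed (hI.toIsPreIsocone.diffSubmodule : Set (Matrix (Fin N) (Fin N) ℂ)) :=
    Submodule.closed_of_finiteDimensional _
  have h := hI.closure_sub
  change closure (hI.toIsPreIsocone.diffSubmodule : Set (Matrix (Fin N) (Fin N) ℂ)) = _ at h
  rw [hcl.closure_eq] at h
  exact h.symm.subset hA

/-- An isocone has nonempty interior relative to the Hermitian matrices. -/
theorem IsIsocone.exists_interior_point (hI : IsIsocone I) :
    ∃ c ∈ I, ∀ᶠ A in 𝓝 c, A.IsHermitian → A ∈ I := by
  have hP := hI.toIsPreIsocone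
  let β := Module.finBasis ℝ (Matrix (Fin N) (Fin N) ℂ)
  -- Hermitian parts of a real basis: they span the Hermitian matrices, possibly redundantly.
  let e := fun k => (1 / 2 : ℝ) • (β k + (β k)ᴴ)
  have he : ∀ k, (e k).IsHermitian := fun k => by
    change (e k)ᴴ = e k
    simp only [e, conjTranspose_smul, conjTranspose_add, conjTranspose_conjTranspose, star_trivial]
    rw [add_comm]
  choose b hb b' hb' hbb using fun k => hI.exists_eq_sub (he k)
  have hexp : ∀ E : Matrix (Fin N) (Fin N) ℂ, E.IsHermitian → ∑ k, β.repr E k • e k = E := by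
    intro E hE
    have h1 : ∑ k, β.repr E k • β k = E := β.sum_repr E
    have h2 : ∑ k, β.repr E k • (β k)ᴴ = E := by
      conv_rhs => rw [← hE.eq, ← h1]
      simp only [conjTranspose_sum, conjTranspose_smul, star_trivial]
    calc ∑ k, β.repr E k • e k
        = (1 / 2 : ℝ) • (∑ k, β.repr E k • β k + ∑ k, β.repr E k • (β k)ᴴ) := by
          rw [← Finset.sum_add_distrib, Finset.smul_sum]
          refine Finset.sum_congr rfl fun k _ => ?_
          rw [← smul_add, smul_comm]
      _ = E := by rw [h1, h2, ← two_smul ℝ E, smul_smul]; norm_num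
  have hc := hP.sum_mem Finset.univ (fun k => b k + b' k)
    fun k _ => hP.add_mem _ (hb k) _ (hb' k)
  refine ⟨∑ k, (b k + b' k), hc, ?_⟩
  set c := ∑ k, (b k + b' k) with hcdef
  have hnear : ∀ᶠ A in 𝓝 c, ∀ k, |β.repr (A - c) k| < 1 := by
    refine eventually_all.2 fun k => ?_
    have hcont : Continuous fun A => |β.repr (A - c) k| :=
      ((β.coord k).continuous_of_finiteDimensional.comp (continuous_id.sub continuous_const)).abs
    refine hcont.continuousAt.eventually_lt continuousAt_const ?_
    simp
  filter_upwards [hnear] with A hA hAh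
  -- With coordinates `t k` of `A - c` and `e k = b k - b' k`, the coefficients `1 ± t k` are
  -- positive as `|t k| < 1`.
  have hsub : A = ∑ k, ((1 + β.repr (A - c) k) • b k + (1 - β.repr (A - c) k) • b' k) := by
    have h1 := hexp (A - c) (hAh.sub (hP.isHermitian hc))
    calc A = c + (A - c) := by abel
      _ = ∑ k, ((b k + b' k) + β.repr (A - c) k • e k) := by
        rw [Finset.sum_add_distrib, h1]
      _ = _ := Finset.sum_congr rfl fun k _ => by
        rw [hbb k]; module
  rw [hsub]
  refine hP.sum_mem _ _ fun k _ => hP.add_mem _ (hP.smul_mem ?_ (hb k)) _ (hP.smul_mem ?_ (hb' k))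
  · linarith [(abs_lt.1 (hA k)).1]
  · linarith [(abs_lt.1 (hA k)).2]

end Interior

/-! ### Rank-one projections: from an open set of lines to all lines -/

section RayProjections

open scoped ComplexOrder

variable {N : ℕ} {I : Set (Matrix (Fin N) (Fin N) ℂ)}

/-- The orthogonal projection onto the line spanned by `x` (zero if `x = 0`). -/
noncomputable def rayProj (x : Fin N → ℂ) : Matrix (Fin N) (Fin N) ℂ :=
  (star x ⬝ᵥ x)⁻¹ • vecMulVec x (star x)

theorem rayProj_mulVec (x y : Fin N → ℂ) :
    rayProj x *ᵥ y = ((star x ⬝ᵥ x)⁻¹ * (star x ⬝ᵥ y)) • x := by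
  rw [rayProj, smul_mulVec, vecMulVec_mulVec, mul_smul, op_smul_eq_smul]

theorem rayProj_mulVec_self {x : Fin N → ℂ} (hx : x ≠ 0) : rayProj x *ᵥ x = x := by
  have : star x ⬝ᵥ x ≠ 0 := by simpa using hx
  rw [rayProj_mulVec, inv_mul_cancel₀ this, one_smul]

theorem rayProj_mulVec_eq_iff {x : Fin N → ℂ} (hx : x ≠ 0) (y : Fin N → ℂ) :
    rayProj x *ᵥ y = y ↔ ∃ c : ℂ, y = c • x := by
  constructor
  · intro h
    exact ⟨_, h.symm.trans (rayProj_mulVec x y)⟩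
  · rintro ⟨c, rfl⟩
    rw [mulVec_smul, rayProj_mulVec_self hx]

theorem rayProj_posSemidef (x : Fin N → ℂ) : (rayProj x).PosSemidef :=
  (posSemidef_vecMulVec_self_star x).smul (inv_nonneg.2 (dotProduct_star_self_nonneg x))

theorem rayProj_mul_self {x : Fin N → ℂ} (hx : x ≠ 0) : rayProj x * rayProj x = rayProj x := by
  refine ext_of_mulVec_single fun i => ?_
  rw [← mulVec_mulVec, rayProj_mulVec x (Pi.single i 1), mulVec_smul, rayProj_mulVec_self hx]

theorem continuousAt_rayProj {x : Fin N → ℂ} (hx : x ≠ 0) :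
    ContinuousAt (rayProj : (Fin N → ℂ) → _) x := by
  have h1 : Continuous fun y : Fin N → ℂ => star y ⬝ᵥ y :=
    continuous_star.dotProduct continuous_id
  have h2 : Continuous fun y : Fin N → ℂ => vecMulVec y (star y) :=
    continuous_id.matrix_vecMulVec continuous_star
  exact (h1.continuousAt.inv₀ (by simpa using hx)).smul h2.continuousAt

theorem Matrix.PosSemidef.mulVec_eq_zero_of_add {A B : Matrix (Fin N) (Fin N) ℂ}
    (hA : A.PosSemidef) (hB : B.PosSemidef) {y : Fin N → ℂ} (h : (A + B) *ᵥ y = 0) :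
    A *ᵥ y = 0 := by
  rw [← hA.dotProduct_mulVec_zero_iff]
  have h1 : star y ⬝ᵥ A *ᵥ y + star y ⬝ᵥ B *ᵥ y = 0 := by
    rw [← dotProduct_add, ← add_mulVec, h, dotProduct_zero]
  exact ((add_eq_zero_iff_of_nonneg (hA.dotProduct_mulVec_nonneg y)
    (hB.dotProduct_mulVec_nonneg y)).1 h1).1

theorem Matrix.IsHermitian.posSemidef_one_sub {P : Matrix (Fin N) (Fin N) ℂ}
    (hP : P.IsHermitian) (hPP : P * P = P) : (1 - P).PosSemidef := by
  have h : (1 - P) = (1 - P)ᴴ * (1 - P) := by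
    rw [(isHermitian_one.sub hP).eq]
    noncomm_ring
    rw [hPP]
    abel
  rw [h]
  exact posSemidef_conjTranspose_mul_self _

theorem IsPreIsocone.rayProj_mem (hI : IsPreIsocone I)
    {A : Matrix (Fin N) (Fin N) ℂ} (hA : A ∈ I) {μ : ℝ}
    (hμ : (algebraMap ℝ _ μ - A).PosSemidef) {x : Fin N → ℂ} (hx : x ≠ 0)
    (h : ∀ y, (algebraMap ℝ _ μ - A) *ᵥ y = 0 ↔ ∃ c : ℂ, y = c • x) : rayProj x ∈ I := by
  obtain ⟨P, hPI, hPP, hP⟩ := hI.exists_top_projection hA hμ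
  suffices P = rayProj x from this ▸ hPI
  refine ext_of_mulVec_single fun i => ?_
  set w : Fin N → ℂ := Pi.single i 1
  obtain ⟨c, hc⟩ := (h (P *ᵥ w)).1 ((hP _).1 (by rw [mulVec_mulVec, hPP]))
  have hPx : P *ᵥ x = x := (hP x).2 ((h x).2 ⟨1, (one_smul _ _).symm⟩)
  have hne : star x ⬝ᵥ x ≠ 0 := by simpa using hx
  have h1 : star x ⬝ᵥ P *ᵥ w = star x ⬝ᵥ w := by
    rw [dotProduct_mulVec, ← (hI.isHermitian hPI).eq, ← star_mulVec, hPx]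
  rw [hc, dotProduct_smul, smul_eq_mul] at h1
  rw [hc, rayProj_mulVec, ← h1, mul_comm c, inv_mul_cancel_left₀ hne]

theorem Matrix.IsHermitian.exists_top_eigenvector [NeZero N] {c : Matrix (Fin N) (Fin N) ℂ}
    (hc : c.IsHermitian) : ∃ (l : ℝ) (u : Fin N → ℂ), u ≠ 0 ∧
      (algebraMap ℝ _ l - c).PosSemidef ∧ (algebraMap ℝ _ l - c) *ᵥ u = 0 := by
  obtain ⟨i, hi⟩ := Finite.exists_max hc.eigenvalues
  refine ⟨hc.eigenvalues i, (hc.eigenvectorBasis i).ofLp, ?_, ?_, ?_⟩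
  · intro h
    refine hc.eigenvectorBasis.toBasis.ne_zero i ?_
    ext j
    simpa using congrFun h j
  · have hD : (algebraMap ℝ (Matrix (Fin N) (Fin N) ℂ) (hc.eigenvalues i) - c).IsHermitian :=
      (IsSelfAdjoint.algebraMap _ (IsSelfAdjoint.all _) : IsSelfAdjoint _).sub hc
    refine hD.posSemidef_iff_eigenvalues_nonneg.2 fun j => ?_
    have h1 := hD.eigenvalues_mem_spectrum_real j
    rw [← spectrum.singleton_sub_eq, hc.spectrum_real_eq_range_eigenvalues] at h1
    obtain ⟨_, rfl, _, ⟨k, rfl⟩, h2⟩ := h1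
    have := hi k
    simp only at h2
    simp only [Pi.zero_apply]
    linarith
  · rw [sub_mulVec, hc.mulVec_eigenvectorBasis, Algebra.algebraMap_eq_smul_one, smul_mulVec,
      one_mulVec, sub_self]

/-- An isocone contains the projections onto all lines near some line. -/
theorem IsIsocone.eventually_rayProj_mem [NeZero N] (hI : IsIsocone I) :
    ∃ u : Fin N → ℂ, ∀ᶠ v in 𝓝 u, rayProj v ∈ I := by
  have hP := hI.toIsPreIsocone
  obtain ⟨c, hcI, hc⟩ := hI.exists_interior_point
  obtain ⟨l, u, hu, hD, hDu⟩ := (hP.isHermitian hcI).exists_top_eigenvector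
  refine ⟨u, ?_⟩
  set D := algebraMap ℝ (Matrix (Fin N) (Fin N) ℂ) l - c with hDdef
  -- `F (δ, v)` has eigenvalue `l + δ` at `v` and is at most `l` on the orthogonal complement of
  -- `v`; `F (0, u) = c`.
  let F : ℝ × (Fin N → ℂ) → Matrix (Fin N) (Fin N) ℂ := fun q =>
    algebraMap ℝ _ l + q.1 • rayProj q.2 - (1 - rayProj q.2) * D * (1 - rayProj q.2)
  have hFherm : ∀ q, (F q).IsHermitian := fun q => by
    have h1 := (rayProj_posSemidef q.2).isHermitian
    have h2 : (1 - rayProj q.2).IsHermitian := isHermitian_one.sub h1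
    have h3 : ((1 - rayProj q.2) * D * (1 - rayProj q.2)).IsHermitian := by
      have := isHermitian_mul_mul_conjTranspose (1 - rayProj q.2) hD.isHermitian
      rwa [h2.eq] at this
    have h4 : (algebraMap ℝ (Matrix (Fin N) (Fin N) ℂ) l).IsHermitian :=
      hP.isHermitian (hP.const_mem l)
    have h5 : (q.1 • rayProj q.2).IsHermitian := by
      change (q.1 • rayProj q.2)ᴴ = _
      rw [conjTranspose_smul, h1.eq, star_trivial]
    exact (h4.add h5).sub h3
  have hDp : D * rayProj u = 0 := by
    refine ext_of_mulVec_single fun i => ?_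
    rw [← mulVec_mulVec, rayProj_mulVec, mulVec_smul, hDu, smul_zero, zero_mulVec]
  have hpD : rayProj u * D = 0 := by
    have := congrArg conjTranspose hDp
    rwa [conjTranspose_mul, hD.isHermitian.eq, (rayProj_posSemidef u).isHermitian.eq,
      conjTranspose_zero] at this
  have hF0 : F (0, u) = c := by
    simp only [F, zero_smul, add_zero]
    rw [sub_mul, one_mul, hpD, sub_zero, mul_sub, mul_one, hDp, sub_zero, hDdef]
    abel
  have hFc : ContinuousAt F (0, u) := by
    have h1 : ContinuousAt (fun q : ℝ × (Fin N → ℂ) => rayProj q.2) (0, u) :=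
      ContinuousAt.comp (f := Prod.snd) (x := ((0 : ℝ), u)) (continuousAt_rayProj hu)
        continuousAt_snd
    have h2 := (continuousAt_const (y := (1 : Matrix (Fin N) (Fin N) ℂ))).sub h1
    exact (continuousAt_const.add (continuousAt_fst.smul h1)).sub
      ((h2.mul continuousAt_const).mul h2)
  have hFI : ∀ᶠ q in 𝓝 ((0 : ℝ), u), F q ∈ I := by
    have h1 : ∀ᶠ q in 𝓝 ((0 : ℝ), u), (F q).IsHermitian → F q ∈ I :=
      hFc.eventually (by rwa [hF0])
    exact h1.mono fun q hq => hq (hFherm q)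
  -- A single `δ > 0` that serves all `v` near `u`.
  obtain ⟨δ, hδ, hδ0⟩ :=
    ((hFI.curry_nhds.filter_mono nhdsWithin_le_nhds).and
      (self_mem_nhdsWithin (s := Set.Ioi (0 : ℝ)))).exists
  have hδ0 : 0 < δ := hδ0
  filter_upwards [hδ, eventually_ne_nhds hu] with v hv hv0
  have hv1 := (rayProj_posSemidef v).isHermitian
  have hv2 : (1 - rayProj v).PosSemidef := hv1.posSemidef_one_sub (rayProj_mul_self hv0)
  have hM : algebraMap ℝ _ (l + δ) - F (δ, v)
      = δ • (1 - rayProj v) + (1 - rayProj v) * D * (1 - rayProj v) := by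
    simp only [F, map_add, smul_sub, Algebra.algebraMap_eq_smul_one]
    abel
  have hM1 : (δ • (1 - rayProj v)).PosSemidef := hv2.smul hδ0.le
  have hM2 : ((1 - rayProj v) * D * (1 - rayProj v)).PosSemidef := by
    have := hD.mul_mul_conjTranspose_same (1 - rayProj v)
    rwa [hv2.isHermitian.eq] at this
  refine hP.rayProj_mem hv (μ := l + δ) (by rw [hM]; exact hM1.add hM2) hv0 fun y => ?_
  rw [← rayProj_mulVec_eq_iff hv0, hM]
  constructor
  · intro h
    have h1 := hM1.mulVec_eq_zero_of_add hM2 h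
    rw [smul_mulVec, smul_eq_zero_iff_right hδ0.ne', sub_mulVec, one_mulVec, sub_eq_zero] at h1
    exact h1.symm
  · intro h
    have h1 : (1 - rayProj v) *ᵥ y = 0 := by rw [sub_mulVec, one_mulVec, h, sub_self]
    rw [add_mulVec, smul_mulVec, ← mulVec_mulVec, h1, smul_zero, mulVec_zero, add_zero]

theorem IsPreIsocone.exists_plane_projection (hI : IsPreIsocone I) {u v : Fin N → ℂ}
    (hu0 : u ≠ 0) (hv0 : v ≠ 0) (hu : rayProj u ∈ I) (hv : rayProj v ∈ I) :
    ∃ P ∈ I, P * P = P ∧ P *ᵥ u = u ∧ P *ᵥ v = v ∧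
      ∀ y, P *ᵥ y = y → ∃ a b : ℂ, y = a • u + b • v := by
  have hpu := rayProj_posSemidef u
  have hpv := rayProj_posSemidef v
  obtain ⟨P, hPI, hPP, hPA, C, hC⟩ := hI.exists_support_projection
    (hI.add_mem _ hu _ hv) (hpu.add hpv)
  have hPh := hI.isHermitian hPI
  -- `p + q` kills the range of `1 - P`; by positivity so does `p` alone.
  have key : ∀ {p q : Matrix (Fin N) (Fin N) ℂ}, p.PosSemidef → q.PosSemidef →
      P * (p + q) = p + q → P * p = p := by
    intro p q hp hq h
    have h1 : (p + q) * P = p + q := by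
      have := congrArg conjTranspose h
      rwa [conjTranspose_mul, (hp.isHermitian.add hq.isHermitian).eq, hPh.eq] at this
    have h2 : p * (1 - P) = 0 := by
      refine ext_of_mulVec_single fun i => ?_
      rw [← mulVec_mulVec, zero_mulVec]
      refine hp.mulVec_eq_zero_of_add hq ?_
      rw [mulVec_mulVec, mul_sub, h1, mul_one, sub_self, zero_mulVec]
    have h3 := congrArg conjTranspose h2
    rw [conjTranspose_mul, hp.isHermitian.eq, (isHermitian_one.sub hPh).eq, conjTranspose_zero,
      sub_mul, one_mul, sub_eq_zero] at h3
    exact h3.symm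
  refine ⟨P, hPI, hPP, ?_, ?_, fun y hy => ?_⟩
  · conv_lhs => rw [← rayProj_mulVec_self hu0]
    rw [mulVec_mulVec, key hpu hpv hPA, rayProj_mulVec_self hu0]
  · conv_lhs => rw [← rayProj_mulVec_self hv0]
    rw [mulVec_mulVec, key hpv hpu (by rwa [add_comm]), rayProj_mulVec_self hv0]
  · rw [hC, ← mulVec_mulVec, add_mulVec, rayProj_mulVec, rayProj_mulVec] at hy
    exact ⟨_, _, hy.symm⟩

/-- If the projections onto all lines near the line of `u` lie in the pre-isocone, then so does a
projection fixing `x` whose range lies in the plane spanned by `x` and `u`. -/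
theorem IsPreIsocone.exists_plane_projection_through (hI : IsPreIsocone I) {x u : Fin N → ℂ}
    (hu : ∀ᶠ v in 𝓝 u, rayProj v ∈ I) (hxu : u ∉ Submodule.span ℂ {x}) :
    ∃ P ∈ I, P * P = P ∧ P *ᵥ x = x ∧
      ∀ y, P *ᵥ y = y → y ∈ Submodule.span ℂ {x, u} := by
  have hcont : Tendsto (fun ε : ℝ => u + (ε : ℂ) • x) (𝓝[>] 0) (𝓝 u) := by
    have : Continuous fun ε : ℝ => u + (ε : ℂ) • x := by fun_prop
    simpa using (this.tendsto 0).mono_left nhdsWithin_le_nhds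
  obtain ⟨ε, hε, hε0⟩ := ((hcont.eventually hu).and
    (self_mem_nhdsWithin (s := Set.Ioi (0 : ℝ)))).exists
  have hε0 : (ε : ℂ) ≠ 0 := by exact_mod_cast (ne_of_gt (show (0 : ℝ) < ε from hε0))
  have hne : ∀ a : ℂ, u + a • x ≠ 0 := fun a h => hxu <|
    Submodule.mem_span_singleton.2 ⟨-a, by rw [neg_smul, eq_comm]; exact eq_neg_of_add_eq_zero_left h⟩
  obtain ⟨P, hPI, hPP, hPu, hPv, hP⟩ := hI.exists_plane_projection (by simpa using hne 0)
    (hne ε) hu.self_of_nhds hε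
  refine ⟨P, hPI, hPP, ?_, fun y hy => ?_⟩
  · rw [mulVec_add, hPu, mulVec_smul] at hPv
    exact smul_right_injective _ hε0 (add_left_cancel hPv)
  · obtain ⟨a, b, rfl⟩ := hP y hy
    exact Submodule.mem_span_pair.2 ⟨b * ε, a + b, by module⟩

theorem exists_mem_notMem_span_pair (hN : 3 ≤ N) {U : Set (Fin N → ℂ)} (hU : IsOpen U)
    (hne : U.Nonempty) (a b : Fin N → ℂ) : ∃ u ∈ U, u ∉ Submodule.span ℂ {a, b} := by
  by_contra! h
  have htop := Submodule.eq_top_of_nonempty_interior' (Submodule.span ℂ {a, b})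
    (hne.mono (interior_maximal h hU))
  have h1 := finrank_range_le_card (R := ℂ) ![a, b]
  rw [Set.finrank, range_cons_cons_empty, htop, finrank_top, Module.finrank_fin_fun,
    Fintype.card_fin] at h1
  omega

theorem IsIsocone.rayProj_mem_of_three_le (hI : IsIsocone I) (hN : 3 ≤ N) {x : Fin N → ℂ}
    (hx : x ≠ 0) : rayProj x ∈ I := by
  have hP := hI.toIsPreIsocone
  have : NeZero N := ⟨by omega⟩
  obtain ⟨u₀, hu₀⟩ := hI.eventually_rayProj_mem
  obtain ⟨U, hUI, hU, hUu⟩ := eventually_nhds_iff.1 hu₀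
  have hev : ∀ v ∈ U, ∀ᶠ w in 𝓝 v, rayProj w ∈ I := fun v hv =>
    (hU.eventually_mem hv).mono hUI
  obtain ⟨u, huU, hu⟩ := exists_mem_notMem_span_pair hN hU ⟨_, hUu⟩ x x
  obtain ⟨v, hvU, hv⟩ := exists_mem_notMem_span_pair hN hU ⟨_, hUu⟩ x u
  rw [Set.pair_eq_singleton] at hu
  have hv' : v ∉ Submodule.span ℂ {x} := fun h => hv (Submodule.span_mono (by simp) h)
  obtain ⟨P, hPI, hPP, hPx, hPs⟩ := hP.exists_plane_projection_through (hev u huU) hu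
  obtain ⟨Q, hQI, hQQ, hQx, hQs⟩ := hP.exists_plane_projection_through (hev v hvU) hv'
  have hP1 := (hP.isHermitian hPI).posSemidef_one_sub hPP
  have hQ1 := (hP.isHermitian hQI).posSemidef_one_sub hQQ
  have hM : algebraMap ℝ _ 2 - (P + Q) = (1 - P) + (1 - Q) := by
    rw [Algebra.algebraMap_eq_smul_one, two_smul]
    abel
  refine hP.rayProj_mem (hP.add_mem _ hPI _ hQI) (μ := 2) (by rw [hM]; exact hP1.add hQ1) hx
    fun y => ?_
  rw [hM]
  constructor
  · intro h
    have h1 := hP1.mulVec_eq_zero_of_add hQ1 h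
    have h2 := hQ1.mulVec_eq_zero_of_add hP1 (by rwa [add_comm])
    rw [sub_mulVec, one_mulVec, sub_eq_zero] at h1 h2
    have h3 := hPs y h1.symm
    obtain ⟨a, b, rfl⟩ := Submodule.mem_span_pair.1 (hQs y h2.symm)
    have hb : b = 0 := by
      by_contra hb
      refine hv ((Submodule.smul_mem_iff _ hb).1 ?_)
      have hax : a • x ∈ Submodule.span ℂ {x, u} :=
        Submodule.smul_mem _ _ (Submodule.subset_span (by simp))
      exact (Submodule.add_mem_iff_right _ hax).1 h3
    exact ⟨a, by rw [hb, zero_smul, add_zero]⟩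
  · rintro ⟨a, rfl⟩
    rw [add_mulVec, sub_mulVec, sub_mulVec, one_mulVec, mulVec_smul, mulVec_smul, hPx, hQx,
      sub_self, add_zero]

theorem IsIsocone.mem_of_isHermitian (hI : IsIsocone I) (hN : 3 ≤ N)
    {A : Matrix (Fin N) (Fin N) ℂ} (hA : A.IsHermitian) : A ∈ I := by
  have hP := hI.toIsPreIsocone
  have : NeZero N := ⟨by omega⟩
  have hray : ∀ x : Fin N → ℂ, vecMulVec x (star x) ∈ I := fun x => by
    by_cases hx : x = 0
    · subst hx
      simpa using hP.const_mem 0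
    have hne : star x ⬝ᵥ x ≠ 0 := by simpa using hx
    have h0 := dotProduct_star_self_nonneg x
    have h1 : vecMulVec x (star x) = (star x ⬝ᵥ x).re • rayProj x := by
      have h2 : (((star x ⬝ᵥ x).re : ℝ) : ℂ) = star x ⬝ᵥ x := (Complex.eq_re_of_ofReal_le h0).symm
      rw [← Complex.coe_smul, h2, rayProj, smul_inv_smul₀ hne]
    rw [h1]
    exact hP.smul_mem (Complex.nonneg_iff.1 h0).1 (hI.rayProj_mem_of_three_le hN hx)
  have hpos : ∀ B : Matrix (Fin N) (Fin N) ℂ, B.PosSemidef → B ∈ I := fun B hB => by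
    obtain ⟨m, v, hv⟩ := posSemidef_iff_eq_sum_vecMulVec.1 hB
    rw [hv]
    exact hP.sum_mem _ _ fun i _ => hray _
  obtain ⟨l, -, -, hl, -⟩ := hA.neg.exists_top_eigenvector
  have h := hP.add_mem _ (hpos _ hl) _ (hP.const_mem (-l))
  rwa [map_neg, sub_neg_eq_add, add_neg_cancel_comm] at h

end RayProjections

theorem isIsocone_herm (N : ℕ) : IsIsocone (Herm N) where
  isSelfAdjoint _ hb := hb
  const_mem _ := IsSelfAdjoint.algebraMap _ (IsSelfAdjoint.all _)
  add_mem _ hb _ hb' := IsHermitian.add hb hb'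
  cfc_mem φ _ _ b _ := cfc_predicate φ b
  isClosed := isClosed_eq continuous_id.matrix_conjTranspose continuous_id
  closure_sub := by
    have h : {x | ∃ b ∈ Herm N, ∃ b' ∈ Herm N, x = b - b'} = Herm N := by
      ext x
      constructor
      · rintro ⟨b, hb, b', hb', rfl⟩
        exact IsHermitian.sub hb hb'
      · exact fun hx => ⟨x, hx, 0, isHermitian_zero, (sub_zero x).symm⟩
    rw [h]
    exact (isClosed_eq continuous_id.matrix_conjTranspose continuous_id :
      IsClosed (Herm N)).closure_eq

theorem mainTheorem2 (N : ℕ) (hN : 3 ≤ N) (I : Set (Matrix (Fin N) (Fin N) ℂ)) :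
    IsIsocone I ↔ I = Herm N := by
  constructor
  · intro hI
    exact Set.Subset.antisymm (fun A hA => hI.isSelfAdjoint A hA)
      fun A hA => hI.mem_of_isHermitian hN hA
  · rintro rfl
    exact isIsocone_herm N
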